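/- **Conventions.** For $n\ge 0$ let $[n]=\{1,\dots,n\}$. A *set operad* is a family of sets $P(n)$, $n\ge 0$, with actions of the symmetric groups $\mathbb S_n$, a unit in $P(1)$ and partial compositions $\circ_i:P(n)\times P(m)\to P(n+m-1)$, $i\in[n]$, satisfying the usual sequential, parallel, equivariance and unit axioms; a *suboperad* is a family of subsets closed under all this structure. An $n$-player *game* is a function $v:2^{[n]}\to\mathbb R$ with $v(\emptyset)=0$. It is *non-negative* if $v(S)\ge 0$ for all $S$, and *convex* if $v(S)+v(T)\le v(S\cap T)+v(S\cup T)$ for all $S,T\subseteq[n]$. Its *core* is $$C(v)=\Big\{x\in\mathbb R^n \;\Big|\; \sum_{j\in[n]}x_j=v([n]),\ \sum_{j\in S}x_j\ge v(S)\ \text{for all } S\subseteq [n]\Big\}.$$ For games $\alpha$ on $A=[n]$, $\beta$ on $B=[m]$ and $i\in[n]$, the game $\alpha\circ_i\beta$ on $(A\setminus\{i\})\cup B$ (identified with $[n+m-1]$ by inserting the players of $B$, in order, at the place of $i$) is $$(\alpha\circ_i\beta)(S)=\beta(B)\,\alpha(S_A)+\big(\alpha(S_A\cup\{i\})-\alpha(S_A)\big)\,\beta(S_B),\qquad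 S_A=S\cap A,\ S_B=S\cap B.$$ The unit is the one-player game with $v(\{1\})=1$, and $\mathbb S_n$ acts by $(\sigma\star v)(S)=v(\sigma^{-1}(S))$. A *generalized permutahedron* in $\mathbb R^n$ (in Postnikov's sense) is a polytope obtained from the standard permutahedron by moving vertices so that edge directions are preserved (edges may degenerate to points), i.e. the convex hull of points $x_w\in\mathbb R^n$, $w\in\mathbb S_n$, such that for every $w$ and every adjacent transposition $s_i=(i\ i{+}1)$ there is $k_{w,i}\ge0$ with $x_w-x_{ws_i}=k_{w,i}\,(e_{w(i)}-e_{w(i+1)})$. The group $\mathbb S_n$ acts on subsets of $\mathbb R^n$ by $e_j\mapsto e_{\sigma(j)}$. **Statement.** With the above structure, games form a set operad, and the non-negative convex games form a suboperad of it. For every $n$, the core $v\mapsto C(v)$ is a bijection from the set of non-negative convex $n$-player games onto the set of generalized permutahedra in $\mathbb R^n$ that are contained in the non-negative orthant $\mathbb R_{\ge0}^n$. Consequently the generalized permutahedra contained in non-negative orthants form a set operad, with the action of $\mathbb S_n$ by permutation of coordinates, with unit $\{1\}\subset\mathbb R^1$, and with $$C(\alpha)\circ_i C(\beta)=C(\alpha\circ_i\beta)$$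 for all non-negative convex games $\alpha,\beta$, and $C$ is an isomorphism of operads. Moreover, there is a set operad structure on the family of all generalized permutahedra, with the action of $\mathbb S_n$ by permutation of coordinates, of which this operad is a suboperad. -/

import Mathlib

open Equiv

namespace GameOperad

/-! ### Set operads given by partial compositions

Arities are natural numbers and inputs are numbered by `Fin n`, so all positions start at `0`.
The arity of a composite `λ ∘ᵢ μ` of an operation of arity `p` with one of arity `q` is `p + q - 1`;
we write it as a number `r` together with a proof of `r + 1 = p + q`. -/

/-- Where an input of the outer operation, other than the `i`-th, ends up in the composite. -/
def outerPos {p q r : ℕ} (h : r + 1 = p + q) (i : Fin p) (a : {a : Fin p // a ≠ i}) : Fin r :=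
  if ha : a.1 < i then ⟨a.1, by omega⟩
  else ⟨a.1 + q - 1, by have := a.2; omega⟩

/-- Where an input of the inner operation ends up in the composite. -/
def innerPos {p q r : ℕ} (h : r + 1 = p + q) (i : Fin p) (b : Fin q) : Fin r :=
  ⟨i + b, by omega⟩

theorem slots_bijective {p q r : ℕ} (h : r + 1 = p + q) (i : Fin p) :
    Function.Bijective (Sum.elim (outerPos h i) (innerPos h i)) := by
  rw [Fintype.bijective_iff_injective_and_card]
  constructor
  · rintro (⟨a, ha⟩ | b) (⟨c, hc⟩ | d) hx
    · simp only [Sum.elim_inl, outerPos] at hx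
      simp only [Sum.inl.injEq, Subtype.mk.injEq]
      split_ifs at hx <;> simp only [Fin.mk.injEq] at hx <;> omega
    · simp only [Sum.elim_inl, Sum.elim_inr, outerPos, innerPos] at hx
      split_ifs at hx <;> simp only [Fin.mk.injEq] at hx <;> omega
    · simp only [Sum.elim_inl, Sum.elim_inr, outerPos, innerPos] at hx
      split_ifs at hx <;> simp only [Fin.mk.injEq] at hx <;> omega
    · simp only [Sum.elim_inr, innerPos, Fin.mk.injEq] at hx
      simp only [Sum.inr.injEq]
      omega
  · simp only [Fintype.card_sum, Fintype.card_fin, Fintype.card_subtype_compl,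
      Fintype.card_unique]
    have := i.2
    omega

/-- The inputs of `λ ∘ᵢ μ` are the inputs of `λ` other than the `i`-th together with
the inputs of `μ`, the latter replacing the `i`-th input of `λ`. -/
noncomputable def slots {p q r : ℕ} (h : r + 1 = p + q) (i : Fin p) :
    {a : Fin p // a ≠ i} ⊕ Fin q ≃ Fin r :=
  Equiv.ofBijective _ (slots_bijective h i)

/-- The permutation of the inputs of a composite at `i` that acts as `σ` on the inputs of the
inner operation and as the identity elsewhere. -/
noncomputable def innerPerm {p q r : ℕ} (h : r + 1 = p + q) (i : Fin p) (σ : Perm (Fin q)) :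
    Perm (Fin r) :=
  (slots h i).symm.trans ((Equiv.sumCongr (Equiv.refl _) σ).trans (slots h i))

/-- The permutation of the inputs of a composite that acts as `τ` on the inputs of the
outer operation and moves the block of inputs of the inner operation, in order,
from position `i` to position `τ i`. -/
noncomputable def outerPerm {p q r : ℕ} (h : r + 1 = p + q) (i : Fin p) (τ : Perm (Fin p)) :
    Perm (Fin r) :=
  (slots h i).symm.trans
    ((Equiv.sumCongr (τ.subtypeEquiv (p := fun a => a ≠ i) (q := fun a => a ≠ τ i)
        fun _ => τ.injective.ne_iff.symm) (Equiv.refl _)).trans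
      (slots h (τ i)))

/-- A (symmetric, unital) set operad with sets of operations `P n`, `n ≥ 0`,
presented by partial compositions. -/
structure SetOperad (P : ℕ → Type*) where
  /-- the action of the symmetric groups -/
  act : ∀ {n : ℕ}, Perm (Fin n) → P n → P n
  /-- the partial composition `λ ∘ᵢ μ`, of arity `r = p + q - 1` -/
  comp : ∀ {p q r : ℕ}, r + 1 = p + q → Fin p → P p → P q → P r
  /-- the unit -/
  one : P 1
  act_one : ∀ {n : ℕ} (x : P n), act 1 x = x
  act_mul : ∀ {n : ℕ} (σ τ : Perm (Fin n)) (x : P n), act (σ * τ) x = act σ (act τ x)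
  /-- `(λ ∘ᵢ μ) ∘ᵢ₊ⱼ ν = λ ∘ᵢ (μ ∘ⱼ ν)` (positions numbered from `0`) -/
  sequential : ∀ {p q r s t u : ℕ} (h₁ : s + 1 = p + q) (h₂ : t + 1 = s + r)
    (h₃ : u + 1 = q + r) (h₄ : t + 1 = p + u) (i : Fin p) (j : Fin q)
    (x : P p) (y : P q) (z : P r),
    comp h₂ (innerPos h₁ i j) (comp h₁ i x y) z = comp h₄ i x (comp h₃ j y z)
  /-- `(λ ∘ᵢ μ) ∘ₖ₊q₋₁ ν = (λ ∘ₖ ν) ∘ᵢ μ` for `i < k` -/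
  parallel : ∀ {p q r s t u : ℕ} (h₁ : s + 1 = p + q) (h₂ : t + 1 = s + r)
    (h₃ : u + 1 = p + r) (h₄ : t + 1 = u + q) (i k : Fin p) (hik : i < k)
    (x : P p) (y : P q) (z : P r),
    comp h₂ (outerPos h₁ i ⟨k, hik.ne'⟩) (comp h₁ i x y) z =
      comp h₄ (outerPos h₃ k ⟨i, hik.ne⟩) (comp h₃ k x z) y
  comp_act : ∀ {p q r : ℕ} (h : r + 1 = p + q) (i : Fin p) (σ : Perm (Fin q))
    (x : P p) (y : P q),
    comp h i x (act σ y) = act (innerPerm h i σ) (comp h i x y)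
  act_comp : ∀ {p q r : ℕ} (h : r + 1 = p + q) (i : Fin p) (τ : Perm (Fin p))
    (x : P p) (y : P q),
    comp h (τ i) (act τ x) y = act (outerPerm h i τ) (comp h i x y)
  comp_one : ∀ {n : ℕ} (i : Fin n) (x : P n), comp (rfl : n + 1 = n + 1) i x one = x
  one_comp : ∀ {n : ℕ} (x : P n), comp (Nat.add_comm n 1) 0 one x = x

/-- Morphisms of set operads. -/
structure IsOperadHom {P Q : ℕ → Type*} (𝒪 : SetOperad P) (𝒪' : SetOperad Q)
    (f : ∀ n, P n → Q n) : Prop where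
  map_act : ∀ {n : ℕ} (σ : Perm (Fin n)) (x : P n), f n (𝒪.act σ x) = 𝒪'.act σ (f n x)
  map_comp : ∀ {p q r : ℕ} (h : r + 1 = p + q) (i : Fin p) (x : P p) (y : P q),
    f r (𝒪.comp h i x y) = 𝒪'.comp h i (f p x) (f q y)
  map_one : f 1 𝒪.one = 𝒪'.one

/-! ### Cooperative games -/

/-- A (grounded) cooperative game with `n` players. -/
@[ext] structure Game (n : ℕ) where
  /-- the coalition function -/
  v : Finset (Fin n) → ℝ
  grounded : v ∅ = 0

namespace Game

/-- `(σ ⋆ v)(S) = v(σ⁻¹(S))` -/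
def act {n : ℕ} (σ : Perm (Fin n)) (Γ : Game n) : Game n where
  v S := Γ.v (S.image fun j => σ⁻¹ j)
  grounded := by simp [Γ.grounded]

/-- `∂ᵢv(S) = v(S ∪ {i}) - v(S \ {i})` -/
def derivative {n : ℕ} (Γ : Game n) (i : Fin n) (S : Finset (Fin n)) : ℝ :=
  Γ.v (insert i S) - Γ.v (S.erase i)

/-- The part `S_A` of a coalition `S` of a composite that consists of outer players. -/
def outerPart {p q r : ℕ} (h : r + 1 = p + q) (i : Fin p) (S : Finset (Fin r)) :
    Finset (Fin p) :=
  Finset.univ.filter fun a => ∃ ha : a ≠ i, outerPos h i ⟨a, ha⟩ ∈ S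

/-- The part `S_B` of a coalition `S` of a composite that consists of inner players. -/
def innerPart {p q r : ℕ} (h : r + 1 = p + q) (i : Fin p) (S : Finset (Fin r)) :
    Finset (Fin q) :=
  Finset.univ.filter fun b => innerPos h i b ∈ S

/-- The partial composition `(α ∘ᵢ β)(S) = β(B) α(S_A) + ∂ᵢα(S_A) β(S_B)`. -/
def comp {p q r : ℕ} (h : r + 1 = p + q) (i : Fin p) (A : Game p) (B : Game q) : Game r where
  v S := B.v Finset.univ * A.v (outerPart h i S) +
    A.derivative i (outerPart h i S) * B.v (innerPart h i S)
  grounded := by simp [outerPart, innerPart, A.grounded, B.grounded]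

/-- The one-player game in which the grand coalition has value `1`. -/
def trivial : Game 1 where
  v S := if S = ∅ then 0 else 1
  grounded := by simp

/-- Convex (supermodular) games. -/
def IsConvex {n : ℕ} (Γ : Game n) : Prop :=
  ∀ S T : Finset (Fin n), Γ.v S + Γ.v T ≤ Γ.v (S ∩ T) + Γ.v (S ∪ T)

/-- Non-negative games. -/
def IsNonneg {n : ℕ} (Γ : Game n) : Prop :=
  ∀ S : Finset (Fin n), 0 ≤ Γ.v S

/-- The core of a game. -/
def core {n : ℕ} (Γ : Game n) : Set (Fin n → ℝ) :=
  {x | ∑ j, x j = Γ.v Finset.univ ∧ ∀ S : Finset (Fin n), Γ.v S ≤ ∑ j ∈ S, x j}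

end Game

/-- Non-negative convex games with `n` players. -/
def NonnegConvexGame (n : ℕ) : Type :=
  {Γ : Game n // Γ.IsNonneg ∧ Γ.IsConvex}

/-! ### Generalized permutahedra -/

/-- Generalized permutahedra in the sense of Postnikov: polytopes obtained from the standard
permutahedron by moving its vertices so that all edge directions are preserved (edges may
degenerate to points). Explicitly, the vertices `x w` are labelled (possibly with repetition)
by permutations `w`, and `x w - x (w sᵢ)` is a non-negative multiple of
`e_{w(i)} - e_{w(i+1)}` for every adjacent transposition `sᵢ = (i i+1)`. -/
def IsGenPermutahedron {n : ℕ} (P : Set (Fin n → ℝ)) : Prop :=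
  ∃ x : Perm (Fin n) → (Fin n → ℝ),
    (∀ (w : Perm (Fin n)) (i j : Fin n), (j : ℕ) = i + 1 →
      ∃ k : ℝ, 0 ≤ k ∧
        x w - x (w * swap i j) = k • (Pi.single (w i) 1 - Pi.single (w j) 1)) ∧
    P = convexHull ℝ (Set.range x)

/-- Generalized permutahedra in `ℝⁿ`. -/
def GenPermutahedron (n : ℕ) : Type :=
  {P : Set (Fin n → ℝ) // IsGenPermutahedron P}

/-- Generalized permutahedra in `ℝⁿ` that are contained in the non-negative orthant. -/
def OrthantGenPermutahedron (n : ℕ) : Type :=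
  {P : Set (Fin n → ℝ) // IsGenPermutahedron P ∧ P ⊆ {x | ∀ j, 0 ≤ x j}}

/-- The action of permutations on subsets of `ℝⁿ` that is induced by `e_j ↦ e_{σ(j)}`. -/
def permuteCoords {n : ℕ} (σ : Perm (Fin n)) (P : Set (Fin n → ℝ)) : Set (Fin n → ℝ) :=
  (fun x j => x (σ⁻¹ j)) '' P

end GameOperad

/-! A composite of games is polynomial in the values of its factors at the parts of a coalition, so
the operad axioms for games reduce to bookkeeping of positions followed by polynomial identities.
Non-negative convex games are monotone; this writes the slack in the convexity inequality of a
composite as a sum of products of non-negative factors (`Game.IsConvex.comp`).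

The core bijection holds for all convex games. Given vertices `x w` with root edges, sorting the
label lowers a linear functional, so the minimum is attained at the label that sorts its
coefficients. The minima at indicator vectors form a convex game (`vertexGame`), whose core is the
hull of the vertices (`HasRootEdges.core_vertexGame`). Conversely, the marginal vectors of a convex
game have root edges and their `vertexGame` is the game itself, so the game is recovered from its
core; non-negative games correspond to cores in the orthant. The operad of orthant polytopes is then
transported along the core.

Without non-negativity, composition need not preserve convexity: composing with a one-player game of
value `-1` negates a game. For the operad of all generalized permutahedra, a convex game is
therefore encoded by the translate whose singleton values are the absolute values, which is
non-negative, together with its vector of singleton values. As the absolute value is multiplicative,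
these pairs are closed under composition in `markedGameOperad`, and convex games inherit its axioms;
on non-negative games nothing changes. -/

namespace GameOperad

/-! ### Constructing operads -/

/-- An operad structure on `P` is induced by a family of injections into an operad
that is compatible with given operations on `P`. -/
def SetOperad.ofInjective {P Q : ℕ → Type*} (𝒪 : SetOperad Q) (f : ∀ n, P n → Q n)
    (hf : ∀ n, Function.Injective (f n))
    (act : ∀ {n : ℕ}, Perm (Fin n) → P n → P n)
    (comp : ∀ {p q r : ℕ}, r + 1 = p + q → Fin p → P p → P q → P r) (one : P 1)
    (map_act : ∀ {n : ℕ} (σ : Perm (Fin n)) (x : P n), f n (act σ x) = 𝒪.act σ (f n x))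
    (map_comp : ∀ {p q r : ℕ} (h : r + 1 = p + q) (i : Fin p) (x : P p) (y : P q),
      f r (comp h i x y) = 𝒪.comp h i (f p x) (f q y))
    (map_one : f 1 one = 𝒪.one) : SetOperad P where
  act := act
  comp := comp
  one := one
  act_one x := hf _ (by rw [map_act, 𝒪.act_one])
  act_mul σ τ x := hf _ (by simp only [map_act, 𝒪.act_mul])
  sequential h₁ h₂ h₃ h₄ i j x y z := hf _ (by
    simp only [map_comp]; exact 𝒪.sequential h₁ h₂ h₃ h₄ i j _ _ _)
  parallel h₁ h₂ h₃ h₄ i k hik x y z := hf _ (by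
    simp only [map_comp]; exact 𝒪.parallel h₁ h₂ h₃ h₄ i k hik _ _ _)
  comp_act h i σ x y := hf _ (by simp only [map_comp, map_act, 𝒪.comp_act])
  act_comp h i τ x y := hf _ (by simp only [map_comp, map_act, 𝒪.act_comp])
  comp_one i x := hf _ (by rw [map_comp, map_one, 𝒪.comp_one])
  one_comp x := hf _ (by rw [map_comp, map_one, 𝒪.one_comp])

/-- Transport of an operad structure along bijections. -/
def SetOperad.transport {P Q : ℕ → Type*} (𝒪 : SetOperad P) (e : ∀ n, P n ≃ Q n) :
    SetOperad Q :=
  𝒪.ofInjective (fun n => (e n).symm) (fun n => (e n).symm.injective)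
    (fun {n} σ x => e n (𝒪.act σ ((e n).symm x)))
    (fun {p q r} h i x y => e r (𝒪.comp h i ((e p).symm x) ((e q).symm y)))
    (e 1 𝒪.one) (by simp) (by simp) (by simp)

theorem SetOperad.isOperadHom_transport {P Q : ℕ → Type*} (𝒪 : SetOperad P)
    (e : ∀ n, P n ≃ Q n) : IsOperadHom 𝒪 (𝒪.transport e) (fun n => e n) where
  map_act σ x := by simp [transport, ofInjective]
  map_comp h i x y := by simp [transport, ofInjective]
  map_one := rfl

/-- A morphism of operads induces a morphism between operads transported along bijections. -/
theorem IsOperadHom.transport {P Q P' Q' : ℕ → Type*} {𝒪 : SetOperad P} {𝒪' : SetOperad Q}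
    {f : ∀ n, P n → Q n} (hf : IsOperadHom 𝒪 𝒪' f) (e : ∀ n, P n ≃ P' n)
    (e' : ∀ n, Q n ≃ Q' n) (g : ∀ n, P' n → Q' n) (hg : ∀ n x, g n (e n x) = e' n (f n x)) :
    IsOperadHom (𝒪.transport e) (𝒪'.transport e') g := by
  have hs : ∀ n x, (e' n).symm (g n x) = f n ((e n).symm x) := fun n x => by
    rw [Equiv.symm_apply_eq, ← hg, Equiv.apply_symm_apply]
  refine ⟨fun σ x => ?_, fun h i x y => ?_, ?_⟩
  · simp [SetOperad.transport, SetOperad.ofInjective, hg, hs, hf.map_act]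
  · simp [SetOperad.transport, SetOperad.ofInjective, hg, hs, hf.map_comp]
  · simp [SetOperad.transport, SetOperad.ofInjective, hg, hf.map_one]

/-! ### Positions of inputs -/

section Positions

variable {p q r s t u : ℕ}

theorem outerPos_val (h : r + 1 = p + q) (i : Fin p) (a : {a : Fin p // a ≠ i}) :
    (outerPos h i a : ℕ) = if (a.1 : ℕ) < i then (a.1 : ℕ) else a.1 + q - 1 := by
  simp only [outerPos, Fin.lt_def]
  split_ifs <;> rfl

theorem innerPos_val (h : r + 1 = p + q) (i : Fin p) (b : Fin q) :
    (innerPos h i b : ℕ) = i + b := rfl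

/-- The inputs of a double composite fall into three blocks, one per factor. This lemma and the next
two follow each block through both bracketings of the sequential axiom; the three `parallel` lemmas
do the same for the parallel axiom. -/
theorem outerPos_sequential (h₁ : s + 1 = p + q) (h₂ : t + 1 = s + r) (h₄ : t + 1 = p + u)
    (i : Fin p) (j : Fin q) (a : {a : Fin p // a ≠ i})
    (ha : outerPos h₁ i a ≠ innerPos h₁ i j) :
    outerPos h₂ (innerPos h₁ i j) ⟨outerPos h₁ i a, ha⟩ = outerPos h₄ i a := by
  obtain ⟨a, hai⟩ := a
  have := Fin.val_ne_of_ne hai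
  have := j.2
  ext
  simp only [outerPos_val, innerPos_val]
  split_ifs <;> omega

theorem outerPos_innerPos (h₁ : s + 1 = p + q) (h₂ : t + 1 = s + r) (h₄ : t + 1 = p + u)
    (h₃ : u + 1 = q + r) (i : Fin p) (j : Fin q) (b : {b : Fin q // b ≠ j})
    (hb : innerPos h₁ i b.1 ≠ innerPos h₁ i j) :
    outerPos h₂ (innerPos h₁ i j) ⟨innerPos h₁ i b.1, hb⟩ =
      innerPos h₄ i (outerPos h₃ j b) := by
  obtain ⟨b, hbj⟩ := b
  have := Fin.val_ne_of_ne hbj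
  ext
  simp only [outerPos_val, innerPos_val, Nat.add_lt_add_iff_left]
  split_ifs <;> omega

theorem innerPos_innerPos (h₁ : s + 1 = p + q) (h₂ : t + 1 = s + r) (h₄ : t + 1 = p + u)
    (h₃ : u + 1 = q + r) (i : Fin p) (j : Fin q) (c : Fin r) :
    innerPos h₂ (innerPos h₁ i j) c = innerPos h₄ i (innerPos h₃ j c) := by
  ext
  simp only [innerPos]
  omega

theorem outerPos_parallel (h₁ : s + 1 = p + q) (h₂ : t + 1 = s + r) (h₃ : u + 1 = p + r)
    (h₄ : t + 1 = u + q) (i k : Fin p) (hik : i < k) (a : Fin p) (hi : a ≠ i) (hk : a ≠ k)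
    (h : outerPos h₁ i ⟨a, hi⟩ ≠ outerPos h₁ i ⟨k, hik.ne'⟩)
    (h' : outerPos h₃ k ⟨a, hk⟩ ≠ outerPos h₃ k ⟨i, hik.ne⟩) :
    outerPos h₂ (outerPos h₁ i ⟨k, hik.ne'⟩) ⟨outerPos h₁ i ⟨a, hi⟩, h⟩ =
      outerPos h₄ (outerPos h₃ k ⟨i, hik.ne⟩) ⟨outerPos h₃ k ⟨a, hk⟩, h'⟩ := by
  have := Fin.val_ne_of_ne hi
  have := Fin.val_ne_of_ne hk
  have := Fin.lt_def.1 hik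
  ext
  simp only [outerPos_val]
  split_ifs <;> omega

theorem outerPos_innerPos_parallel (h₁ : s + 1 = p + q) (h₂ : t + 1 = s + r)
    (h₃ : u + 1 = p + r) (h₄ : t + 1 = u + q) (i k : Fin p) (hik : i < k) (b : Fin q)
    (h : innerPos h₁ i b ≠ outerPos h₁ i ⟨k, hik.ne'⟩) :
    outerPos h₂ (outerPos h₁ i ⟨k, hik.ne'⟩) ⟨innerPos h₁ i b, h⟩ =
      innerPos h₄ (outerPos h₃ k ⟨i, hik.ne⟩) b := by
  have := Fin.lt_def.1 hik
  ext
  simp only [outerPos_val, innerPos_val]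
  split_ifs <;> omega

theorem innerPos_outerPos_parallel (h₁ : s + 1 = p + q) (h₂ : t + 1 = s + r)
    (h₃ : u + 1 = p + r) (h₄ : t + 1 = u + q) (i k : Fin p) (hik : i < k) (c : Fin r)
    (h : innerPos h₃ k c ≠ outerPos h₃ k ⟨i, hik.ne⟩) :
    innerPos h₂ (outerPos h₁ i ⟨k, hik.ne'⟩) c =
      outerPos h₄ (outerPos h₃ k ⟨i, hik.ne⟩) ⟨innerPos h₃ k c, h⟩ := by
  have := Fin.lt_def.1 hik
  ext
  simp only [outerPos_val, innerPos_val]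
  split_ifs <;> omega

theorem outerPos_injective (h : r + 1 = p + q) (i : Fin p) :
    Function.Injective (outerPos h i) :=
  (Sum.elim_injective.1 (slots_bijective h i).1).1

theorem innerPos_injective (h : r + 1 = p + q) (i : Fin p) :
    Function.Injective (innerPos h i) :=
  (Sum.elim_injective.1 (slots_bijective h i).1).2.1

theorem outerPos_ne_innerPos (h : r + 1 = p + q) (i : Fin p) (a : {a : Fin p // a ≠ i})
    (b : Fin q) : outerPos h i a ≠ innerPos h i b :=
  (Sum.elim_injective.1 (slots_bijective h i).1).2.2 a b

theorem slots_inl (h : r + 1 = p + q) (i : Fin p) (a : {a : Fin p // a ≠ i}) :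
    slots h i (Sum.inl a) = outerPos h i a := rfl

theorem slots_inr (h : r + 1 = p + q) (i : Fin p) (b : Fin q) :
    slots h i (Sum.inr b) = innerPos h i b := rfl

theorem forall_slots (h : r + 1 = p + q) (i : Fin p) {M : Fin r → Prop}
    (ho : ∀ a, M (outerPos h i a)) (hi : ∀ b, M (innerPos h i b)) (j : Fin r) : M j := by
  obtain ⟨a | b, rfl⟩ := (slots_bijective h i).2 j
  exacts [ho a, hi b]

theorem innerPerm_outerPos (h : r + 1 = p + q) (i : Fin p) (σ : Perm (Fin q))
    (a : {a : Fin p // a ≠ i}) : innerPerm h i σ (outerPos h i a) = outerPos h i a := by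
  simp [innerPerm, ← slots_inl]

theorem innerPerm_innerPos (h : r + 1 = p + q) (i : Fin p) (σ : Perm (Fin q)) (b : Fin q) :
    innerPerm h i σ (innerPos h i b) = innerPos h i (σ b) := by
  simp [innerPerm, ← slots_inr]

theorem outerPerm_outerPos (h : r + 1 = p + q) (i : Fin p) (τ : Perm (Fin p)) (a : Fin p)
    (ha : a ≠ i) : outerPerm h i τ (outerPos h i ⟨a, ha⟩) =
      outerPos h (τ i) ⟨τ a, τ.injective.ne ha⟩ := by
  simp [outerPerm, ← slots_inl]

theorem outerPerm_innerPos (h : r + 1 = p + q) (i : Fin p) (τ : Perm (Fin p)) (b : Fin q) :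
    outerPerm h i τ (innerPos h i b) = innerPos h (τ i) b := by
  simp [outerPerm, ← slots_inr]

end Positions

namespace Game

/-! ### Parts of coalitions -/

section Parts

variable {p q r s t u : ℕ}

theorem mem_image_inv {n : ℕ} (σ : Perm (Fin n)) (S : Finset (Fin n)) (a : Fin n) :
    a ∈ S.image (fun j => σ⁻¹ j) ↔ σ a ∈ S := by
  simp only [Finset.mem_image]
  constructor
  · rintro ⟨b, hb, rfl⟩; simpa using hb
  · exact fun h => ⟨σ a, h, by simp⟩

theorem mem_innerPart (h : r + 1 = p + q) (i : Fin p) (S : Finset (Fin r)) (b : Fin q) :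
    b ∈ innerPart h i S ↔ innerPos h i b ∈ S := by simp [innerPart]

theorem mem_outerPart (h : r + 1 = p + q) (i : Fin p) (S : Finset (Fin r)) (a : Fin p) :
    a ∈ outerPart h i S ↔ ∃ ha : a ≠ i, outerPos h i ⟨a, ha⟩ ∈ S := by simp [outerPart]

theorem mem_outerPart_of_ne (h : r + 1 = p + q) (i : Fin p) (S : Finset (Fin r)) (a : Fin p)
    (ha : a ≠ i) : a ∈ outerPart h i S ↔ outerPos h i ⟨a, ha⟩ ∈ S := by
  simp [mem_outerPart, ha]

theorem notMem_outerPart (h : r + 1 = p + q) (i : Fin p) (S : Finset (Fin r)) :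
    i ∉ outerPart h i S := by simp [mem_outerPart]

theorem erase_outerPart (h : r + 1 = p + q) (i : Fin p) (S : Finset (Fin r)) :
    (outerPart h i S).erase i = outerPart h i S :=
  Finset.erase_eq_of_notMem (notMem_outerPart h i S)

theorem outerPart_univ (h : r + 1 = p + q) (i : Fin p) :
    outerPart h i Finset.univ = Finset.univ.erase i := by
  ext a; simp [mem_outerPart]

theorem innerPart_univ (h : r + 1 = p + q) (i : Fin p) :
    innerPart h i Finset.univ = Finset.univ := by
  ext b; simp [mem_innerPart]

theorem outerPart_inter (h : r + 1 = p + q) (i : Fin p) (S T : Finset (Fin r)) :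
    outerPart h i (S ∩ T) = outerPart h i S ∩ outerPart h i T := by
  ext a; by_cases ha : a = i <;> simp [mem_outerPart, ha]

theorem outerPart_union (h : r + 1 = p + q) (i : Fin p) (S T : Finset (Fin r)) :
    outerPart h i (S ∪ T) = outerPart h i S ∪ outerPart h i T := by
  ext a; by_cases ha : a = i <;> simp [mem_outerPart, ha]

theorem innerPart_inter (h : r + 1 = p + q) (i : Fin p) (S T : Finset (Fin r)) :
    innerPart h i (S ∩ T) = innerPart h i S ∩ innerPart h i T := by
  ext a; simp [mem_innerPart]

theorem innerPart_union (h : r + 1 = p + q) (i : Fin p) (S T : Finset (Fin r)) :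
    innerPart h i (S ∪ T) = innerPart h i S ∪ innerPart h i T := by
  ext a; simp [mem_innerPart]

theorem outerPart_insert_innerPos (h : r + 1 = p + q) (i : Fin p) (b : Fin q)
    (S : Finset (Fin r)) :
    outerPart h i (insert (innerPos h i b) S) = outerPart h i S := by
  ext a; simp [mem_outerPart, outerPos_ne_innerPos]

theorem innerPart_insert_innerPos (h : r + 1 = p + q) (i : Fin p) (b : Fin q)
    (S : Finset (Fin r)) :
    innerPart h i (insert (innerPos h i b) S) = insert b (innerPart h i S) := by
  ext a; simp [mem_innerPart, (innerPos_injective h i).eq_iff]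

theorem innerPart_insert_outerPos (h : r + 1 = p + q) (i : Fin p) (a : {a : Fin p // a ≠ i})
    (S : Finset (Fin r)) :
    innerPart h i (insert (outerPos h i a) S) = innerPart h i S := by
  ext b; simp [mem_innerPart, (outerPos_ne_innerPos h i a b).symm]

theorem outerPart_insert_outerPos (h : r + 1 = p + q) (i : Fin p) (a : {a : Fin p // a ≠ i})
    (S : Finset (Fin r)) :
    outerPart h i (insert (outerPos h i a) S) = insert a.1 (outerPart h i S) := by
  ext b
  by_cases hb : b = i
  · subst hb; simp [mem_outerPart, a.2.symm]
  · simp [mem_outerPart, (outerPos_injective h i).eq_iff, Subtype.ext_iff, hb]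

theorem outerPart_outerPart (h₁ : s + 1 = p + q) (h₂ : t + 1 = s + r) (h₄ : t + 1 = p + u)
    (i : Fin p) (j : Fin q) (S : Finset (Fin t)) :
    outerPart h₁ i (outerPart h₂ (innerPos h₁ i j) S) = outerPart h₄ i S := by
  ext a
  simp [mem_outerPart, outerPos_ne_innerPos, outerPos_sequential h₁ h₂ h₄]

theorem innerPart_outerPart (h₁ : s + 1 = p + q) (h₂ : t + 1 = s + r) (h₃ : u + 1 = q + r)
    (h₄ : t + 1 = p + u) (i : Fin p) (j : Fin q) (S : Finset (Fin t)) :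
    innerPart h₁ i (outerPart h₂ (innerPos h₁ i j) S) =
      outerPart h₃ j (innerPart h₄ i S) := by
  ext b
  by_cases hb : b = j
  · subst hb; simp [mem_outerPart, mem_innerPart]
  · have hb' := (innerPos_injective h₁ i).ne hb
    rw [mem_innerPart, mem_outerPart_of_ne _ _ _ _ hb', mem_outerPart_of_ne _ _ _ _ hb,
      mem_innerPart, outerPos_innerPos h₁ h₂ h₄ h₃ i j ⟨b, hb⟩ hb']

theorem innerPart_innerPart (h₁ : s + 1 = p + q) (h₂ : t + 1 = s + r) (h₃ : u + 1 = q + r)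
    (h₄ : t + 1 = p + u) (i : Fin p) (j : Fin q) (S : Finset (Fin t)) :
    innerPart h₂ (innerPos h₁ i j) S = innerPart h₃ j (innerPart h₄ i S) := by
  ext c
  simp [mem_innerPart, innerPos_innerPos h₁ h₂ h₄ h₃]

theorem outerPart_parallel (h₁ : s + 1 = p + q) (h₂ : t + 1 = s + r) (h₃ : u + 1 = p + r)
    (h₄ : t + 1 = u + q) (i k : Fin p) (hik : i < k) (S : Finset (Fin t)) :
    outerPart h₁ i (outerPart h₂ (outerPos h₁ i ⟨k, hik.ne'⟩) S) =
      outerPart h₃ k (outerPart h₄ (outerPos h₃ k ⟨i, hik.ne⟩) S) := by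
  ext a
  by_cases hi : a = i
  · subst hi; simp [mem_outerPart]
  by_cases hk : a = k
  · subst hk; simp [mem_outerPart]
  have h := (outerPos_injective h₁ i).ne (a₁ := ⟨a, hi⟩) (a₂ := ⟨k, hik.ne'⟩) (by simpa)
  have h' := (outerPos_injective h₃ k).ne (a₁ := ⟨a, hk⟩) (a₂ := ⟨i, hik.ne⟩) (by simpa)
  rw [mem_outerPart_of_ne _ _ _ _ hi, mem_outerPart_of_ne _ _ _ _ h,
    mem_outerPart_of_ne _ _ _ _ hk, mem_outerPart_of_ne _ _ _ _ h',
    outerPos_parallel h₁ h₂ h₃ h₄ i k hik a hi hk h h']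

theorem innerPart_outerPart_left (h₁ : s + 1 = p + q) (h₂ : t + 1 = s + r)
    (h₃ : u + 1 = p + r) (h₄ : t + 1 = u + q) (i k : Fin p) (hik : i < k)
    (S : Finset (Fin t)) :
    innerPart h₁ i (outerPart h₂ (outerPos h₁ i ⟨k, hik.ne'⟩) S) =
      innerPart h₄ (outerPos h₃ k ⟨i, hik.ne⟩) S := by
  ext b
  have h := (outerPos_ne_innerPos h₁ i ⟨k, hik.ne'⟩ b).symm
  rw [mem_innerPart, mem_outerPart_of_ne _ _ _ _ h, mem_innerPart,
    outerPos_innerPos_parallel h₁ h₂ h₃ h₄ i k hik b h]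

theorem innerPart_outerPart_right (h₁ : s + 1 = p + q) (h₂ : t + 1 = s + r)
    (h₃ : u + 1 = p + r) (h₄ : t + 1 = u + q) (i k : Fin p) (hik : i < k)
    (S : Finset (Fin t)) :
    innerPart h₃ k (outerPart h₄ (outerPos h₃ k ⟨i, hik.ne⟩) S) =
      innerPart h₂ (outerPos h₁ i ⟨k, hik.ne'⟩) S := by
  ext c
  have h := (outerPos_ne_innerPos h₃ k ⟨i, hik.ne⟩ c).symm
  rw [mem_innerPart, mem_outerPart_of_ne _ _ _ _ h, mem_innerPart,
    innerPos_outerPos_parallel h₁ h₂ h₃ h₄ i k hik c h]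

end Parts

/-! ### The operad of games -/

section Operad

variable {p q r s t u : ℕ}

theorem comp_v (h : r + 1 = p + q) (i : Fin p) (A : Game p) (B : Game q)
    (S : Finset (Fin r)) : (comp h i A B).v S =
      B.v Finset.univ * A.v (outerPart h i S) +
        (A.v (insert i (outerPart h i S)) - A.v (outerPart h i S)) *
          B.v (innerPart h i S) := by
  simp only [comp, derivative, erase_outerPart]

/-- Grand coalition values multiply. The sequential axiom needs this for the factor `β(B)` when `β`
is itself a composite. -/
theorem comp_v_univ (h : r + 1 = p + q) (i : Fin p) (A : Game p) (B : Game q) :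
    (comp h i A B).v Finset.univ = A.v Finset.univ * B.v Finset.univ := by
  rw [comp_v, outerPart_univ, innerPart_univ, Finset.insert_erase (Finset.mem_univ i)]
  ring

theorem act_one {n : ℕ} (A : Game n) : act 1 A = A := by
  ext S; simp [act]

theorem act_mul {n : ℕ} (σ τ : Perm (Fin n)) (A : Game n) :
    act (σ * τ) A = act σ (act τ A) := by
  ext S; simp [act, Finset.image_image, Function.comp_def]

theorem comp_sequential (h₁ : s + 1 = p + q) (h₂ : t + 1 = s + r) (h₃ : u + 1 = q + r)
    (h₄ : t + 1 = p + u) (i : Fin p) (j : Fin q) (A : Game p) (B : Game q) (C : Game r) :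
    comp h₂ (innerPos h₁ i j) (comp h₁ i A B) C = comp h₄ i A (comp h₃ j B C) := by
  ext S
  -- Only the outermost composition on the right is unfolded here, so that the grand coalition value
  -- of `comp h₃ j B C` is simplified as a product before the general unfolding.
  simp only [comp_v _ _ A (comp h₃ j B C), comp_v_univ]
  simp only [comp_v, outerPart_insert_innerPos, innerPart_insert_innerPos,
    outerPart_outerPart h₁ h₂ h₄, innerPart_outerPart h₁ h₂ h₃ h₄,
    innerPart_innerPart h₁ h₂ h₃ h₄]
  ring

theorem comp_parallel (h₁ : s + 1 = p + q) (h₂ : t + 1 = s + r) (h₃ : u + 1 = p + r)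
    (h₄ : t + 1 = u + q) (i k : Fin p) (hik : i < k) (A : Game p) (B : Game q) (C : Game r) :
    comp h₂ (outerPos h₁ i ⟨k, hik.ne'⟩) (comp h₁ i A B) C =
      comp h₄ (outerPos h₃ k ⟨i, hik.ne⟩) (comp h₃ k A C) B := by
  ext S
  simp only [comp_v, outerPart_insert_outerPos, innerPart_insert_outerPos,
    outerPart_parallel h₁ h₂ h₃ h₄ i k hik, innerPart_outerPart_left h₁ h₂ h₃ h₄ i k hik,
    innerPart_outerPart_right h₁ h₂ h₃ h₄ i k hik]
  rw [Finset.insert_comm i k]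
  ring

theorem comp_act (h : r + 1 = p + q) (i : Fin p) (σ : Perm (Fin q)) (A : Game p)
    (B : Game q) : comp h i A (act σ B) = act (innerPerm h i σ) (comp h i A B) := by
  ext S
  have ho : outerPart h i (S.image fun j => (innerPerm h i σ)⁻¹ j) = outerPart h i S := by
    ext a; simp only [mem_outerPart, mem_image_inv, innerPerm_outerPos]
  have hi : innerPart h i (S.image fun j => (innerPerm h i σ)⁻¹ j) =
      (innerPart h i S).image fun j => σ⁻¹ j := by
    ext b; simp only [mem_innerPart, mem_image_inv, innerPerm_innerPos]
  have hu : (Finset.univ.image fun j => σ⁻¹ j) = Finset.univ := by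
    ext b; simp only [mem_image_inv, Finset.mem_univ]
  rw [comp_v]
  simp only [act]
  rw [comp_v, ho, hi, hu]

theorem act_comp (h : r + 1 = p + q) (i : Fin p) (τ : Perm (Fin p)) (A : Game p)
    (B : Game q) : comp h (τ i) (act τ A) B = act (outerPerm h i τ) (comp h i A B) := by
  ext S
  have ho : outerPart h i (S.image fun j => (outerPerm h i τ)⁻¹ j) =
      (outerPart h (τ i) S).image fun j => τ⁻¹ j := by
    ext a
    simp only [mem_outerPart, mem_image_inv, outerPerm_outerPos, τ.injective.ne_iff]
  have hi : innerPart h i (S.image fun j => (outerPerm h i τ)⁻¹ j) =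
      innerPart h (τ i) S := by
    ext b; simp only [mem_innerPart, mem_image_inv, outerPerm_innerPos]
  rw [comp_v]
  simp only [act]
  rw [comp_v, ho, hi, Finset.image_insert, Perm.inv_def, Equiv.symm_apply_apply]

theorem comp_trivial {n : ℕ} (i : Fin n) (A : Game n) :
    comp (rfl : n + 1 = n + 1) i A trivial = A := by
  have ho : ∀ a : {a : Fin n // a ≠ i}, outerPos (rfl : n + 1 = n + 1) i a = a.1 := by
    intro a; ext; simp only [outerPos]; split_ifs <;> simp
  have hi : ∀ b, innerPos (rfl : n + 1 = n + 1) i b = i := by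
    intro b; ext; simp [innerPos]
  ext S
  have hS : outerPart (rfl : n + 1 = n + 1) i S = S.erase i := by
    ext a; simp [mem_outerPart, ho]
  rw [comp_v, hS]
  by_cases h : i ∈ S
  · have hne : innerPart (rfl : n + 1 = n + 1) i S ≠ ∅ :=
      Finset.Nonempty.ne_empty ⟨0, by simpa [mem_innerPart, hi] using h⟩
    simp [trivial, hne, Finset.insert_erase h]
  · have hne : innerPart (rfl : n + 1 = n + 1) i S = ∅ := by
      ext b; simp [mem_innerPart, hi, h]
    simp [trivial, hne, Finset.erase_eq_of_notMem h]

theorem trivial_comp {n : ℕ} (A : Game n) : comp (Nat.add_comm n 1) 0 trivial A = A := by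
  ext S
  have ho : outerPart (Nat.add_comm n 1) 0 S = ∅ := by
    ext a; simp [mem_outerPart, Subsingleton.elim a 0]
  have hi : innerPart (Nat.add_comm n 1) 0 S = S := by
    ext b; simp [mem_innerPart, innerPos]
  rw [comp_v, ho, hi]
  simp [trivial]

/-- The operad of cooperative games. -/
def operad : SetOperad Game where
  act := act
  comp := comp
  one := trivial
  act_one := act_one
  act_mul := act_mul
  sequential := comp_sequential
  parallel := comp_parallel
  comp_act := comp_act
  act_comp := act_comp
  comp_one := comp_trivial
  one_comp := trivial_comp

end Operad

/-! ### Non-negative convex games -/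

/-- On disjoint sets convexity is superadditivity, and the added part `T \ S` has non-negative
value. Derivatives of such games are thus non-negative. -/
theorem IsConvex.mono {n : ℕ} {A : Game n} (hA : A.IsConvex) (h0 : A.IsNonneg)
    {S T : Finset (Fin n)} (h : S ⊆ T) : A.v S ≤ A.v T := by
  have := hA S (T \ S)
  rw [Finset.inter_sdiff_self, Finset.union_sdiff_of_subset h, A.grounded] at this
  have := h0 (T \ S)
  linarith

theorem IsConvex.act {n : ℕ} {A : Game n} (hA : A.IsConvex) (σ : Perm (Fin n)) :
    (A.act σ).IsConvex := fun S T => by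
  simp only [Game.act]
  rw [Finset.image_inter _ _ (σ⁻¹).injective, Finset.image_union]
  exact hA _ _

theorem IsNonneg.act {n : ℕ} {A : Game n} (hA : A.IsNonneg) (σ : Perm (Fin n)) :
    (A.act σ).IsNonneg := fun _ => hA _

theorem isNonneg_trivial : trivial.IsNonneg := fun S => by
  simp only [trivial]; split_ifs <;> norm_num

theorem isConvex_trivial : trivial.IsConvex := fun S T => by
  have h : ∀ S : Finset (Fin 1), S = ∅ ∨ S = Finset.univ := by decide
  obtain rfl | rfl := h S <;> obtain rfl | rfl := h T <;> simp [trivial]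

section Comp

variable {p q r : ℕ}

theorem IsNonneg.comp (h : r + 1 = p + q) (i : Fin p) {A : Game p} {B : Game q}
    (hA : A.IsNonneg) (hA' : A.IsConvex) (hB : B.IsNonneg) :
    (Game.comp h i A B).IsNonneg := fun S => by
  rw [comp_v]
  have := hA'.mono hA (Finset.subset_insert i (outerPart h i S))
  exact add_nonneg (mul_nonneg (hB _) (hA _)) (mul_nonneg (by linarith) (hB _))

theorem IsConvex.comp (h : r + 1 = p + q) (i : Fin p) {A : Game p} {B : Game q}
    (hA : A.IsConvex) (hA' : A.IsNonneg) (hB : B.IsConvex) (hB' : B.IsNonneg) :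
    (Game.comp h i A B).IsConvex := fun S T => by
  simp only [comp_v, outerPart_inter, outerPart_union, innerPart_inter, innerPart_union]
  have hU := notMem_outerPart h i S
  have hV := notMem_outerPart h i T
  generalize outerPart h i S = U at *
  generalize outerPart h i T = V at *
  generalize innerPart h i S = X at *
  generalize innerPart h i T = Y at *
  have e₀ := hA U V
  have e₁ : A.v (insert i U) + A.v (insert i V) ≤
      A.v (insert i (U ∩ V)) + A.v (insert i (U ∪ V)) := by
    have := hA (insert i U) (insert i V)
    rwa [← Finset.insert_inter_distrib, ← Finset.insert_union_distrib] at this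
  -- Supermodularity in the form used below: the derivative at `i` grows from `U ∩ V` to `U` and to
  -- `V`.
  have e₂ : ∀ W, i ∉ W → A.v W + A.v (insert i (U ∩ V)) ≤
      A.v (W ∩ (U ∩ V)) + A.v (insert i (W ∪ (U ∩ V))) := fun W hW => by
    have := hA W (insert i (U ∩ V))
    rwa [Finset.inter_insert_of_notMem hW, Finset.union_insert] at this
  have e₃ := e₂ U hU
  have e₄ := e₂ V hV
  rw [Finset.inter_eq_right.2 Finset.inter_subset_left,
    Finset.union_eq_left.2 Finset.inter_subset_left] at e₃
  rw [Finset.inter_eq_right.2 Finset.inter_subset_right,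
    Finset.union_eq_left.2 Finset.inter_subset_right] at e₄
  have e₅ := hA.mono hA' (Finset.subset_insert i (U ∩ V))
  have f₀ := hB X Y
  have f₁ := hB.mono hB' (Finset.subset_univ (X ∪ Y))
  have f₂ := hB.mono hB' (Finset.subset_union_left (s₁ := X) (s₂ := Y))
  have f₃ := hB.mono hB' (Finset.subset_union_right (s₁ := X) (s₂ := Y))
  have f₄ := hB' (X ∪ Y)
  generalize B.v (X ∪ Y) = w at *
  generalize B.v (X ∩ Y) = z at *
  generalize B.v X = x at *
  generalize B.v Y = y at *
  -- The slack is exactly the sum of these five products. With `D` the derivative at `i`, the last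
  -- three are `(D U - D (U ∩ V)) * (w - x)`, `(D V - D (U ∩ V)) * (w - y)` and `D (U ∩ V) * (z + w
  -- - x - y)`.
  nlinarith [mul_nonneg (sub_nonneg.2 f₁) (sub_nonneg.2 e₀),
    mul_nonneg f₄ (sub_nonneg.2 e₁), mul_nonneg (sub_nonneg.2 e₃) (sub_nonneg.2 f₂),
    mul_nonneg (sub_nonneg.2 e₄) (sub_nonneg.2 f₃),
    mul_nonneg (sub_nonneg.2 e₅) (sub_nonneg.2 f₀)]

end Comp

end Game

/-- The suboperad of non-negative convex games. -/
def NonnegConvexGame.operad : SetOperad NonnegConvexGame :=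
  Game.operad.ofInjective (fun _ Γ => Γ.1) (fun _ => Subtype.val_injective)
    (fun σ Γ => ⟨Γ.1.act σ, Γ.2.1.act σ, Γ.2.2.act σ⟩)
    (fun h i A B => ⟨Game.comp h i A.1 B.1, A.2.1.comp h i A.2.2 B.2.1,
      A.2.2.comp h i A.2.1 B.2.2 B.2.1⟩)
    ⟨Game.trivial, Game.isNonneg_trivial, Game.isConvex_trivial⟩
    (fun _ _ => rfl) (fun _ _ _ _ => rfl) rfl

/-! ### Vertex data of generalized permutahedra -/

section VertexData

variable {n : ℕ}

/-- The condition on the labelled vertices of a generalized permutahedron. -/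
def HasRootEdges (x : Perm (Fin n) → (Fin n → ℝ)) : Prop :=
  ∀ (w : Perm (Fin n)) (i j : Fin n), (j : ℕ) = i + 1 →
    ∃ k : ℝ, 0 ≤ k ∧ x w - x (w * swap i j) = k • (Pi.single (w i) 1 - Pi.single (w j) 1)

theorem sum_mul_single_sub_single (c : Fin n → ℝ) (a b : Fin n) :
    ∑ j, c j * (Pi.single a 1 - Pi.single b 1 : Fin n → ℝ) j = c a - c b := by
  simp [mul_sub, Finset.sum_sub_distrib, Pi.single_apply]

/-- Along the edge the functional changes by `k * (c (w i) - c (w j))`, so putting the entry with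
smaller coefficient first cannot increase it. -/
theorem HasRootEdges.sum_mul_swap_le {x : Perm (Fin n) → (Fin n → ℝ)} (hx : HasRootEdges x)
    (c : Fin n → ℝ) (w : Perm (Fin n)) {i j : Fin n} (hij : (j : ℕ) = i + 1)
    (hc : c (w j) ≤ c (w i)) :
    ∑ a, c a * x (w * swap i j) a ≤ ∑ a, c a * x w a := by
  obtain ⟨k, hk, h⟩ := hx w i j hij
  rw [← sub_nonneg, ← Finset.sum_sub_distrib]
  have : ∀ a, c a * x w a - c a * x (w * swap i j) a =
      k * (c a * (Pi.single (w i) 1 - Pi.single (w j) 1 : Fin n → ℝ) a) := fun a => by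
    have := congrFun h a
    simp only [Pi.sub_apply, Pi.smul_apply, smul_eq_mul] at this ⊢
    rw [← mul_sub, this]; ring
  rw [Finset.sum_congr rfl fun a _ => this a, ← Finset.mul_sum, sum_mul_single_sub_single]
  exact mul_nonneg hk (sub_nonneg.2 hc)

theorem eq_one_of_forall_adjacent_le (u : Perm (Fin n))
    (h : ∀ i j : Fin n, (j : ℕ) = i + 1 → u i ≤ u j) : u = 1 := by
  have hm : Monotone u := by
    cases n with
    | zero => exact fun i => i.elim0
    | succ n => exact Fin.monotone_iff_le_succ.2 fun i => h _ _ (by simp)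
  let e : Fin n ≃o Fin n := (hm.strictMono_of_injective u.injective).orderIsoOfSurjective u
    u.surjective
  ext i
  have : e i = OrderIso.refl (Fin n) i := by rw [Subsingleton.elim e]
  simpa [e] using congrArg Fin.val this

/-- Swapping adjacent entries in the wrong order increases `∑ a, a * u a`. -/
theorem sum_mul_lt_sum_mul_swap (u : Perm (Fin n)) {i j : Fin n} (hij : (j : ℕ) = i + 1)
    (h : u j < u i) :
    ∑ a, ((u a : ℕ) : ℝ) * (a : ℕ) < ∑ a, (((u * swap i j) a : ℕ) : ℝ) * (a : ℕ) := by
  have e : ∑ a, (((u * swap i j) a : ℕ) : ℝ) * (a : ℕ) =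
      ∑ a, ((u a : ℕ) : ℝ) * (swap i j a : ℕ) := by
    rw [← Equiv.sum_comp (swap i j)]; simp
  rw [e, ← sub_pos, ← Finset.sum_sub_distrib]
  have hne : i ≠ j := by rintro rfl; omega
  have hs : ∀ a, ((swap i j a : ℕ) : ℝ) - (a : ℕ) =
      (Pi.single i 1 - Pi.single j 1 : Fin n → ℝ) a := fun a => by
    rcases eq_or_ne a i with rfl | hai
    · simp [hij, hne]
    · rcases eq_or_ne a j with rfl | haj
      · simp [hij, hne.symm]
      · simp [swap_apply_of_ne_of_ne, hai, haj]
  simp only [← mul_sub, hs]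
  rw [sum_mul_single_sub_single (fun a => ((u a : ℕ) : ℝ))]
  simpa using h

/-- A linear functional attains its minimum at the vertices whose label sorts it. -/
theorem HasRootEdges.sum_mul_le {x : Perm (Fin n) → (Fin n → ℝ)} (hx : HasRootEdges x)
    {c : Fin n → ℝ} {w : Perm (Fin n)} (hc : Monotone (c ∘ w)) (u : Perm (Fin n)) :
    ∑ a, c a * x w a ≤ ∑ a, c a * x u a := by
  classical
  -- Bubble sort phrased as a maximum: among labels whose value is at most that of `u`, take one
  -- with `w⁻¹ * m` as sorted as possible. A remaining descent could be swapped without raising the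
  -- value, so `m = w`.
  obtain ⟨m, hm, hmax⟩ := (Finset.univ.filter fun m =>
    ∑ a, c a * x m a ≤ ∑ a, c a * x u a).exists_max_image
      (fun m => ∑ a, (((w⁻¹ * m) a : ℕ) : ℝ) * (a : ℕ)) ⟨u, by simp⟩
  simp only [Finset.mem_filter, Finset.mem_univ, true_and] at hm hmax
  by_cases h : ∀ i j : Fin n, (j : ℕ) = i + 1 → (w⁻¹ * m) i ≤ (w⁻¹ * m) j
  · rwa [← inv_mul_eq_one.1 (eq_one_of_forall_adjacent_le _ h)] at hm
  · push Not at h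
    obtain ⟨i, j, hij, hlt⟩ := h
    refine absurd (hmax (m * swap i j) ((hx.sum_mul_swap_le c m hij ?_).trans hm)) ?_
    · simpa using hc hlt.le
    · rw [not_le, ← mul_assoc]
      exact sum_mul_lt_sum_mul_swap _ hij hlt

/-- `S` consists of the last entries of the word `w`. -/
def IsFinal (w : Perm (Fin n)) (S : Finset (Fin n)) : Prop :=
  ∀ i j, i ≤ j → w i ∈ S → w j ∈ S

theorem exists_isFinal {S T : Finset (Fin n)} (h : S ⊆ T) :
    ∃ w : Perm (Fin n), IsFinal w S ∧ IsFinal w T := by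
  -- Sorting by these weights puts `S` last, preceded by `T \ S`.
  let f : Fin n → ℕ := fun a => if a ∈ S then 2 else if a ∈ T then 1 else 0
  refine ⟨Tuple.sort f, fun i j hij hi => ?_, fun i j hij hi => ?_⟩ <;>
  · have := Tuple.monotone_sort f hij
    simp only [Function.comp_apply, f, hi, if_true] at this
    split_ifs at this <;> first | omega | assumption | exact h ‹_›

theorem HasRootEdges.sum_le {x : Perm (Fin n) → (Fin n → ℝ)} (hx : HasRootEdges x)
    {w : Perm (Fin n)} {S : Finset (Fin n)} (hS : IsFinal w S) (u : Perm (Fin n)) :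
    ∑ a ∈ S, x w a ≤ ∑ a ∈ S, x u a := by
  have := hx.sum_mul_le (c := fun a => if a ∈ S then 1 else 0) (w := w) (fun i j hij => by
    by_cases h : w i ∈ S
    · simp [h, hS i j hij h]
    · simp only [Function.comp_apply, h, if_false]; split_ifs <;> norm_num) u
  simpa using this

/-! ### The convex game of a generalized permutahedron -/

/-- The lower support function of the points `x w` at indicator vectors. -/
noncomputable def vertexGame (x : Perm (Fin n) → (Fin n → ℝ)) : Game n where
  v S := Finset.univ.inf' Finset.univ_nonempty fun w => ∑ a ∈ S, x w a
  grounded := by simp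

theorem vertexGame_v_le (x : Perm (Fin n) → (Fin n → ℝ)) (w : Perm (Fin n))
    (S : Finset (Fin n)) : (vertexGame x).v S ≤ ∑ a ∈ S, x w a :=
  Finset.inf'_le (fun w => ∑ a ∈ S, x w a) (Finset.mem_univ w)

theorem HasRootEdges.vertexGame_v {x : Perm (Fin n) → (Fin n → ℝ)} (hx : HasRootEdges x)
    {w : Perm (Fin n)} {S : Finset (Fin n)} (hS : IsFinal w S) :
    (vertexGame x).v S = ∑ a ∈ S, x w a :=
  le_antisymm (vertexGame_v_le x w S)
    (Finset.le_inf' Finset.univ_nonempty _ fun u _ => hx.sum_le hS u)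

/-- A single label attains the minima for both `S ∩ T` and `S ∪ T`, while for `S` and `T` it only
gives upper bounds; coordinate sums are modular. -/
theorem HasRootEdges.isConvex_vertexGame {x : Perm (Fin n) → (Fin n → ℝ)}
    (hx : HasRootEdges x) : (vertexGame x).IsConvex := fun S T => by
  obtain ⟨w, h₁, h₂⟩ := exists_isFinal
    (Finset.inter_subset_left.trans Finset.subset_union_left : S ∩ T ⊆ S ∪ T)
  rw [hx.vertexGame_v h₁, hx.vertexGame_v h₂]
  have := vertexGame_v_le x w S
  have := vertexGame_v_le x w T
  have := Finset.sum_union_inter (s₁ := S) (s₂ := T) (f := x w)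
  linarith

/-- An inequality form of summation by parts. -/
theorem mul_sum_le_sum_mul : ∀ {n : ℕ} {f g : Fin n → ℝ}, Monotone f →
    (∀ m, 0 ≤ ∑ p, if m ≤ p then g p else 0) → ∀ b, (∀ p, b ≤ f p) →
    b * ∑ p, g p ≤ ∑ p, f p * g p
  | 0, _, _, _, _, _, _ => by simp
  | n + 1, f, g, hf, hg, b, hb => by
    -- The tail is bounded using its own lower bound `f 0`, which combines with the head to `f 0`
    -- times the total; the total is non-negative, so `f 0` may be lowered to `b`.
    have h := mul_sum_le_sum_mul (f := fun p => f p.succ) (g := fun p => g p.succ)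
      (fun i j hij => hf (by simpa using hij))
      (fun m => by simpa [Fin.sum_univ_succ] using hg m.succ) (f 0) (fun p => hf (Fin.zero_le _))
    have h0 := hg 0
    simp only [Fin.zero_le, if_true] at h0
    have := mul_le_mul_of_nonneg_right (hb 0) h0
    rw [Fin.sum_univ_succ] at this ⊢
    rw [Fin.sum_univ_succ]
    linarith

/-- Up to a constant, which `d` kills because its total is zero, `c` is a non-negative combination
of indicators of final sets of `w`. -/
theorem sum_mul_nonneg_of_isFinal {c d : Fin n → ℝ} {w : Perm (Fin n)}
    (hc : Monotone (c ∘ w)) (hd : ∀ S, IsFinal w S → 0 ≤ ∑ a ∈ S, d a)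
    (h0 : ∑ a, d a = 0) : 0 ≤ ∑ a, c a * d a := by
  obtain ⟨b, hb⟩ := (Set.finite_range (c ∘ w)).bddBelow
  have := mul_sum_le_sum_mul (f := c ∘ w) (g := d ∘ w) hc (fun m => by
    have := hd (Finset.univ.filter fun a => m ≤ w⁻¹ a) (fun i j hij hi => by
      simp only [Finset.mem_filter, Finset.mem_univ, true_and, Perm.inv_def,
        Equiv.symm_apply_apply] at hi ⊢
      exact hi.trans hij)
    rw [Finset.sum_filter, ← Equiv.sum_comp w] at this
    simpa using this) b (fun p => hb ⟨p, rfl⟩)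
  simp only [Function.comp_apply, Equiv.sum_comp w d, h0, mul_zero,
    Equiv.sum_comp w fun a => c a * d a] at this
  exact this

theorem Game.convex_core (A : Game n) : Convex ℝ A.core := by
  rintro x ⟨hx, hx'⟩ y ⟨hy, hy'⟩ a b ha hb hab
  simp only [Game.core, Set.mem_ofPred_eq, Pi.add_apply, Pi.smul_apply, smul_eq_mul,
    Finset.sum_add_distrib, ← Finset.mul_sum]
  refine ⟨by rw [hx, hy, ← add_mul, hab, one_mul], fun S => ?_⟩
  calc A.v S = a * A.v S + b * A.v S := by rw [← add_mul, hab, one_mul]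
    _ ≤ _ := add_le_add (mul_le_mul_of_nonneg_left (hx' S) ha)
      (mul_le_mul_of_nonneg_left (hy' S) hb)

theorem HasRootEdges.mem_core {x : Perm (Fin n) → (Fin n → ℝ)} (hx : HasRootEdges x)
    (w : Perm (Fin n)) : x w ∈ (vertexGame x).core :=
  ⟨(hx.vertexGame_v fun _ _ _ _ => Finset.mem_univ _).symm, vertexGame_v_le x w⟩

theorem HasRootEdges.core_vertexGame {x : Perm (Fin n) → (Fin n → ℝ)} (hx : HasRootEdges x) :
    (vertexGame x).core = convexHull ℝ (Set.range x) := by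
  refine Set.Subset.antisymm (fun y hy => ?_)
    (convexHull_min (Set.range_subset_iff.2 hx.mem_core) (Game.convex_core _))
  by_contra hn
  obtain ⟨f, b, hfy, hfb⟩ := geometric_hahn_banach_point_closed (convex_convexHull ℝ _)
    ((Set.finite_range x).isClosed_convexHull ℝ) hn
  let c : Fin n → ℝ := fun j => f fun i => if j = i then 1 else 0
  have hf : ∀ z, f z = ∑ j, c j * z j := fun z => by
    have := LinearMap.pi_apply_eq_sum_univ f.toLinearMap z
    simpa [c, mul_comm] using this
  have hw := Tuple.monotone_sort c
  set w := Tuple.sort c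
  have h1 := hfb (x w) (subset_convexHull ℝ _ ⟨w, rfl⟩)
  -- The vertex `x w` minimizes the separating functional even over the core: on final sets of `w`
  -- its coordinate sums are the core bounds. This contradicts the separation of `y` from the hull.
  have h2 : 0 ≤ ∑ a, c a * (y a - x w a) := by
    refine sum_mul_nonneg_of_isFinal hw (fun S hS => ?_) ?_
    · rw [Finset.sum_sub_distrib, ← hx.vertexGame_v hS]
      exact sub_nonneg.2 (hy.2 S)
    · rw [Finset.sum_sub_distrib, hy.1, (hx.mem_core w).1, sub_self]
  rw [hf] at hfy h1
  simp only [mul_sub, Finset.sum_sub_distrib] at h2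
  linarith

end VertexData

/-! ### Cores of convex games -/

namespace Game

variable {n : ℕ}

/-- The marginal vector of a game for the reverse of the order `w 0, w 1, …` of the players. -/
def marginal (A : Game n) (w : Perm (Fin n)) (c : Fin n) : ℝ :=
  A.v (Finset.univ.filter fun k => w⁻¹ c ≤ w⁻¹ k) -
    A.v (Finset.univ.filter fun k => w⁻¹ c < w⁻¹ k)

/-- Swapping two adjacent players changes only their own marginal contributions, by opposite
amounts. The amount is the mixed second difference of the game at the set `U` of players behind
both, non-negative by convexity. -/
theorem IsConvex.hasRootEdges_marginal {A : Game n} (hA : A.IsConvex) :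
    HasRootEdges A.marginal := by
  intro w i j hij
  have hne : i ≠ j := by rintro rfl; omega
  set U := Finset.univ.filter fun k => j < w⁻¹ k with hU
  have e₁ : (Finset.univ.filter fun k => i ≤ w⁻¹ k) = insert (w i) (insert (w j) U) := by
    ext k; obtain ⟨p, rfl⟩ := w.surjective k
    simp only [hU, Finset.mem_filter, Finset.mem_univ, true_and, Finset.mem_insert,
      w.injective.eq_iff, Perm.inv_def, Equiv.symm_apply_apply, Fin.ext_iff, Fin.le_def,
      Fin.lt_def]
    omega
  have e₂ : (Finset.univ.filter fun k => i < w⁻¹ k) = insert (w j) U := by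
    ext k; obtain ⟨p, rfl⟩ := w.surjective k
    simp only [hU, Finset.mem_filter, Finset.mem_univ, true_and, Finset.mem_insert,
      w.injective.eq_iff, Perm.inv_def, Equiv.symm_apply_apply, Fin.ext_iff, Fin.lt_def]
    omega
  have e₃ : (Finset.univ.filter fun k => j ≤ w⁻¹ k) = insert (w j) U := by
    ext k; obtain ⟨p, rfl⟩ := w.surjective k
    simp only [hU, Finset.mem_filter, Finset.mem_univ, true_and, Finset.mem_insert,
      w.injective.eq_iff, Perm.inv_def, Equiv.symm_apply_apply, Fin.ext_iff, Fin.le_def,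
      Fin.lt_def]
    omega
  have f₁ : (Finset.univ.filter fun k => i ≤ swap i j (w⁻¹ k)) =
      insert (w i) (insert (w j) U) := by
    ext k; obtain ⟨p, rfl⟩ := w.surjective k
    simp only [hU, Finset.mem_filter, Finset.mem_univ, true_and, Finset.mem_insert,
      w.injective.eq_iff, Perm.inv_def, Equiv.symm_apply_apply, swap_apply_def, Fin.ext_iff,
      Fin.le_def, Fin.lt_def]
    split_ifs <;> omega
  have f₂ : (Finset.univ.filter fun k => i < swap i j (w⁻¹ k)) = insert (w i) U := by
    ext k; obtain ⟨p, rfl⟩ := w.surjective k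
    simp only [hU, Finset.mem_filter, Finset.mem_univ, true_and, Finset.mem_insert,
      w.injective.eq_iff, Perm.inv_def, Equiv.symm_apply_apply, swap_apply_def, Fin.ext_iff,
      Fin.lt_def]
    split_ifs <;> omega
  have f₃ : (Finset.univ.filter fun k => j ≤ swap i j (w⁻¹ k)) = insert (w i) U := by
    ext k; obtain ⟨p, rfl⟩ := w.surjective k
    simp only [hU, Finset.mem_filter, Finset.mem_univ, true_and, Finset.mem_insert,
      w.injective.eq_iff, Perm.inv_def, Equiv.symm_apply_apply, swap_apply_def, Fin.ext_iff,
      Fin.le_def, Fin.lt_def]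
    split_ifs <;> omega
  have f₄ : (Finset.univ.filter fun k => j < swap i j (w⁻¹ k)) = U := by
    ext k; obtain ⟨p, rfl⟩ := w.surjective k
    simp only [hU, Finset.mem_filter, Finset.mem_univ, true_and,
      Perm.inv_def, Equiv.symm_apply_apply, swap_apply_def, Fin.ext_iff, Fin.lt_def]
    split_ifs <;> omega
  have hi : w i ∉ U := by
    simp only [hU, Finset.mem_filter, Finset.mem_univ, true_and, Perm.inv_def,
      Equiv.symm_apply_apply, Fin.lt_def]
    omega
  have hj : w j ∉ U := by simp [hU]
  refine ⟨A.v (insert (w i) (insert (w j) U)) - A.v (insert (w j) U) -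
    A.v (insert (w i) U) + A.v U, ?_, ?_⟩
  · have := hA (insert (w i) U) (insert (w j) U)
    rw [Finset.insert_inter_of_notMem (by simp [hi, hne]),
      Finset.inter_eq_left.2 (Finset.subset_insert _ _), Finset.insert_union,
      Finset.union_eq_right.2 (Finset.subset_insert _ _)] at this
    linarith
  · funext c
    obtain ⟨p, rfl⟩ := w.surjective c
    simp only [Pi.sub_apply, Pi.smul_apply, smul_eq_mul, marginal, mul_inv_rev, swap_inv,
      Perm.coe_mul, Function.comp_apply]
    have hwp : w⁻¹ (w p) = p := by simp
    rw [hwp]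
    rcases eq_or_ne p i with rfl | hpi
    · rw [swap_apply_left, e₁, e₂, f₃, f₄]
      simp [w.injective.ne hne]
      ring
    rcases eq_or_ne p j with rfl | hpj
    · rw [swap_apply_right, e₃, ← hU, f₁, f₂]
      simp [w.injective.ne hpi]
      ring
    -- Since `i` and `j` are adjacent, the swap moves nothing across a third position `p`.
    · have g : ∀ q : Fin n, (p ≤ swap i j q ↔ p ≤ q) ∧ (p < swap i j q ↔ p < q) := fun q => by
        have := Fin.val_ne_of_ne hpi
        have := Fin.val_ne_of_ne hpj
        simp only [swap_apply_def, Fin.ext_iff, Fin.le_def, Fin.lt_def]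
        split_ifs <;> omega
      simp [swap_apply_of_ne_of_ne hpi hpj, g, hpi, hpj]

/-- The sum telescopes: removing the first player of `S` in the order `w` leaves a final set, and
that player's marginal is the difference of the two values. -/
theorem sum_marginal_of_isFinal (A : Game n) {w : Perm (Fin n)} (S : Finset (Fin n))
    (hS : IsFinal w S) : ∑ a ∈ S, A.marginal w a = A.v S := by
  induction S using Finset.strongInduction with
  | H S ih =>
    rcases S.eq_empty_or_nonempty with rfl | hne
    · simp [A.grounded]
    · obtain ⟨c, hc, hmin⟩ := S.exists_min_image (fun a => w⁻¹ a) hne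
      have h₁ : (Finset.univ.filter fun k => w⁻¹ c ≤ w⁻¹ k) = S := by
        ext k
        simp only [Finset.mem_filter, Finset.mem_univ, true_and]
        exact ⟨fun h => by simpa using hS _ _ h (by simpa using hc), hmin k⟩
      have h₂ : (Finset.univ.filter fun k => w⁻¹ c < w⁻¹ k) = S.erase c := by
        ext k
        rw [Finset.mem_erase, ← h₁]
        simp only [Finset.mem_filter, Finset.mem_univ, true_and, lt_iff_le_and_ne,
          (w⁻¹).injective.ne_iff]
        rw [and_comm, ne_comm]
      have h₃ : IsFinal w (S.erase c) := fun i j hij hi => by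
        rw [← h₂] at hi ⊢
        simp only [Finset.mem_filter, Finset.mem_univ, true_and, Perm.inv_def,
          Equiv.symm_apply_apply] at hi ⊢
        exact hi.trans_le hij
      rw [← Finset.add_sum_erase S _ hc, ih _ (Finset.erase_ssubset hc) h₃, marginal, h₁, h₂]
      ring

theorem IsConvex.vertexGame_marginal {A : Game n} (hA : A.IsConvex) :
    vertexGame A.marginal = A := by
  ext S
  obtain ⟨w, h, -⟩ := exists_isFinal (Finset.Subset.refl S)
  rw [hA.hasRootEdges_marginal.vertexGame_v h, sum_marginal_of_isFinal A S h]

theorem IsConvex.isGenPermutahedron_core {A : Game n} (hA : A.IsConvex) :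
    IsGenPermutahedron A.core :=
  ⟨A.marginal, hA.hasRootEdges_marginal, by
    rw [← hA.hasRootEdges_marginal.core_vertexGame, hA.vertexGame_marginal]⟩

theorem exists_isConvex_core_eq {P : Set (Fin n → ℝ)} (hP : IsGenPermutahedron P) :
    ∃ A : Game n, A.IsConvex ∧ A.core = P := by
  obtain ⟨x, hx, rfl⟩ := hP
  exact ⟨vertexGame x, HasRootEdges.isConvex_vertexGame hx, HasRootEdges.core_vertexGame hx⟩

/-- Every lower bound of a convex game is attained on its core. -/
theorem IsConvex.exists_mem_core {A : Game n} (hA : A.IsConvex) (S : Finset (Fin n)) :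
    ∃ x ∈ A.core, ∑ a ∈ S, x a = A.v S := by
  obtain ⟨w, h, -⟩ := exists_isFinal (Finset.Subset.refl S)
  refine ⟨A.marginal w, ?_, sum_marginal_of_isFinal A S h⟩
  have := hA.hasRootEdges_marginal.mem_core w
  rwa [hA.vertexGame_marginal] at this

/-- A convex game is the lower support function of its core, by tightness of all bounds. -/
theorem IsConvex.eq_of_core_eq {A B : Game n} (hA : A.IsConvex) (hB : B.IsConvex)
    (h : A.core = B.core) : A = B := by
  have key : ∀ {A B : Game n}, A.IsConvex → A.core = B.core → ∀ S, B.v S ≤ A.v S := by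
    intro A B hA h S
    obtain ⟨x, hx, hxS⟩ := hA.exists_mem_core S
    rw [← hxS]
    exact (h ▸ hx : x ∈ B.core).2 S
  ext S
  exact le_antisymm (key hB h.symm S) (key hA h S)

theorem IsConvex.isNonneg_iff_core_subset {A : Game n} (hA : A.IsConvex) :
    A.IsNonneg ↔ A.core ⊆ {x | ∀ j, 0 ≤ x j} := by
  refine ⟨fun h x hx j => ?_, fun h S => ?_⟩
  · simpa using (h {j}).trans (hx.2 {j})
  · obtain ⟨x, hx, hxS⟩ := hA.exists_mem_core S
    rw [← hxS]
    exact Finset.sum_nonneg fun j _ => h hx j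

theorem core_act (σ : Perm (Fin n)) (A : Game n) :
    (A.act σ).core = permuteCoords σ A.core := by
  have hsum : ∀ (y : Fin n → ℝ) (S : Finset (Fin n)),
      ∑ j ∈ S.image (fun j => σ⁻¹ j), y (σ j) = ∑ j ∈ S, y j := fun y S => by
    rw [Finset.sum_image (σ⁻¹).injective.injOn]; simp
  have huniv : (Finset.univ.image fun j => σ⁻¹ j) = Finset.univ := by
    ext b; simp only [mem_image_inv, Finset.mem_univ]
  ext y
  constructor
  · rintro ⟨h₁, h₂⟩
    refine ⟨fun j => y (σ j), ⟨?_, fun S => ?_⟩, by ext j; simp⟩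
    · rw [Equiv.sum_comp σ y, h₁]; simp only [act, huniv]
    · have := h₂ (S.image σ)
      simp only [act, Finset.image_image, Function.comp_def] at this
      rw [Finset.sum_image σ.injective.injOn] at this
      simpa using this
  · rintro ⟨x, ⟨h₁, h₂⟩, rfl⟩
    refine ⟨?_, fun S => ?_⟩
    · simp only [act, huniv]; rw [Equiv.sum_comp σ⁻¹ x, h₁]
    · have := h₂ (S.image fun j => σ⁻¹ j)
      rwa [Finset.sum_image (σ⁻¹).injective.injOn] at this

end Game

/-- Convex games with `n` players. -/
def ConvexGame (n : ℕ) : Type := {Γ : Game n // Γ.IsConvex}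

/-- The core as a bijection from convex games to generalized permutahedra. -/
noncomputable def ConvexGame.coreEquiv (n : ℕ) : ConvexGame n ≃ GenPermutahedron n :=
  Equiv.ofBijective (fun Γ => ⟨Γ.1.core, Γ.2.isGenPermutahedron_core⟩)
    ⟨fun A B h => Subtype.ext (A.2.eq_of_core_eq B.2 (congrArg Subtype.val h)), fun P => by
      obtain ⟨A, hA, hP⟩ := Game.exists_isConvex_core_eq P.2
      exact ⟨⟨A, hA⟩, Subtype.ext hP⟩⟩

/-- The core as a bijection from non-negative convex games to generalized permutahedra in the
non-negative orthant. -/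
noncomputable def NonnegConvexGame.coreEquiv (n : ℕ) :
    NonnegConvexGame n ≃ OrthantGenPermutahedron n :=
  Equiv.ofBijective (fun Γ => ⟨Γ.1.core, Γ.2.2.isGenPermutahedron_core,
      Γ.2.2.isNonneg_iff_core_subset.1 Γ.2.1⟩)
    ⟨fun A B h => Subtype.ext (A.2.2.eq_of_core_eq B.2.2 (congrArg Subtype.val h)), fun P => by
      obtain ⟨A, hA, hP⟩ := Game.exists_isConvex_core_eq P.2.1
      exact ⟨⟨A, hA.isNonneg_iff_core_subset.2 (hP ▸ P.2.2), hA⟩, Subtype.ext hP⟩⟩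

/-! ### The operad of convex games

A convex game is determined by the vector of values of its singletons and by its translate in which
these values are replaced by their absolute values, which is non-negative. -/

section Slots

variable {p q r : ℕ}

/-- The vector on the inputs of a composite that is `c • a` on the outer inputs and `a i • b` on
the inner ones. -/
noncomputable def slotVector (h : r + 1 = p + q) (i : Fin p) (c : ℝ) (a : Fin p → ℝ)
    (b : Fin q → ℝ) (j : Fin r) : ℝ :=
  Sum.elim (fun x : {x : Fin p // x ≠ i} => c * a x) (fun y => a i * b y) ((slots h i).symm j)

theorem slotVector_outerPos (h : r + 1 = p + q) (i : Fin p) (c : ℝ) (a : Fin p → ℝ)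
    (b : Fin q → ℝ) (x : {x : Fin p // x ≠ i}) :
    slotVector h i c a b (outerPos h i x) = c * a x := by
  simp [slotVector, ← slots_inl]

theorem slotVector_innerPos (h : r + 1 = p + q) (i : Fin p) (c : ℝ) (a : Fin p → ℝ)
    (b : Fin q → ℝ) (y : Fin q) :
    slotVector h i c a b (innerPos h i y) = a i * b y := by
  simp [slotVector, ← slots_inr]

end Slots

/-- The operad of games with a marking of the players by real numbers. -/
noncomputable def markedGameOperad : SetOperad fun n => Game n × (Fin n → ℝ) where
  act σ x := (x.1.act σ, fun j => x.2 (σ⁻¹ j))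
  -- Markings compose as the singleton values of games do (`Game.singles_comp`), but may carry other
  -- signs.
  comp h i x y := (Game.comp h i x.1 y.1, slotVector h i (y.1.v Finset.univ) x.2 y.2)
  one := (Game.trivial, fun _ => 1)
  act_one x := by simp [Game.act_one]
  act_mul σ τ x := by simp [Game.act_mul]
  sequential h₁ h₂ h₃ h₄ i j x y z := by
    refine Prod.ext (Game.comp_sequential h₁ h₂ h₃ h₄ i j _ _ _) (funext ?_)
    refine forall_slots h₂ (innerPos h₁ i j) ?_ fun c => ?_
    · rintro ⟨a, ha⟩
      revert a
      refine forall_slots h₁ i (fun a ha => ?_) (fun b hb => ?_)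
      · dsimp only
        rw [slotVector_outerPos, slotVector_outerPos, outerPos_sequential h₁ h₂ h₄,
          slotVector_outerPos, Game.comp_v_univ]
        ring
      · have hbj : b ≠ j := by rintro rfl; exact hb rfl
        dsimp only
        rw [slotVector_outerPos, slotVector_innerPos,
          outerPos_innerPos h₁ h₂ h₄ h₃ i j ⟨b, hbj⟩, slotVector_innerPos, slotVector_outerPos]
        ring
    · dsimp only
      rw [slotVector_innerPos, slotVector_innerPos, innerPos_innerPos h₁ h₂ h₄ h₃,
        slotVector_innerPos, slotVector_innerPos]
      ring
  parallel h₁ h₂ h₃ h₄ i k hik x y z := by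
    refine Prod.ext (Game.comp_parallel h₁ h₂ h₃ h₄ i k hik _ _ _) (funext ?_)
    refine forall_slots h₂ (outerPos h₁ i ⟨k, hik.ne'⟩) ?_ fun c => ?_
    · rintro ⟨a, ha⟩
      revert a
      refine forall_slots h₁ i ?_ (fun b hb => ?_)
      · rintro ⟨a, hi⟩ ha
        have hk : a ≠ k := by rintro rfl; exact ha rfl
        have h' := (outerPos_injective h₃ k).ne (a₁ := ⟨a, hk⟩) (a₂ := ⟨i, hik.ne⟩) (by simpa)
        dsimp only
        rw [slotVector_outerPos, slotVector_outerPos,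
          outerPos_parallel h₁ h₂ h₃ h₄ i k hik a hi hk ha h',
          slotVector_outerPos, slotVector_outerPos]
        ring
      · dsimp only
        rw [slotVector_outerPos, slotVector_innerPos,
          outerPos_innerPos_parallel h₁ h₂ h₃ h₄ i k hik b, slotVector_innerPos,
          slotVector_outerPos]
        ring
    · have h := (outerPos_ne_innerPos h₃ k ⟨i, hik.ne⟩ c).symm
      dsimp only
      rw [slotVector_innerPos, slotVector_outerPos,
        innerPos_outerPos_parallel h₁ h₂ h₃ h₄ i k hik c h, slotVector_outerPos,
        slotVector_innerPos]
      ring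
  comp_act h i σ x y := by
    refine Prod.ext (Game.comp_act h i σ _ _) (funext fun j => ?_)
    obtain ⟨j, rfl⟩ := (innerPerm h i σ).surjective j
    have hu : (y.1.act σ).v Finset.univ = y.1.v Finset.univ := by
      simp [Game.act, Finset.image_univ_equiv]
    simp only [Perm.inv_def, Equiv.symm_apply_apply, hu]
    revert j
    refine forall_slots h i (fun a => ?_) (fun b => ?_)
    · rw [innerPerm_outerPos, slotVector_outerPos, slotVector_outerPos]
    · rw [innerPerm_innerPos, slotVector_innerPos, slotVector_innerPos, Equiv.symm_apply_apply]
  act_comp h i τ x y := by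
    refine Prod.ext (Game.act_comp h i τ _ _) (funext fun j => ?_)
    obtain ⟨j, rfl⟩ := (outerPerm h i τ).surjective j
    simp only [Perm.inv_def, Equiv.symm_apply_apply]
    revert j
    refine forall_slots h i ?_ (fun b => ?_)
    · rintro ⟨a, ha⟩
      rw [outerPerm_outerPos, slotVector_outerPos, slotVector_outerPos, Equiv.symm_apply_apply]
    · rw [outerPerm_innerPos, slotVector_innerPos, slotVector_innerPos, Equiv.symm_apply_apply]
  comp_one i x := by
    refine Prod.ext (Game.comp_trivial i _) (funext ?_)
    refine forall_slots (rfl : _ + 1 = _ + 1) i (fun a => ?_) (fun b => ?_)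
    · have : outerPos (rfl : _ + 1 = _ + 1) i a = a.1 := by
        ext; rw [outerPos_val]; split_ifs <;> simp
      dsimp only
      rw [slotVector_outerPos, this]
      simp [Game.trivial]
    · have : innerPos (rfl : _ + 1 = _ + 1) i b = i := by
        ext; simp [innerPos]
      dsimp only
      rw [slotVector_innerPos, this, mul_one]
  one_comp x := by
    refine Prod.ext (Game.trivial_comp _) (funext ?_)
    refine forall_slots (Nat.add_comm _ 1) 0 (fun a => absurd (Subsingleton.elim _ _) a.2)
      (fun b => ?_)
    have : innerPos (Nat.add_comm _ 1) 0 b = b := by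
      ext; simp [innerPos]
    dsimp only
    rw [slotVector_innerPos, this, one_mul]

/-! ### Translates of games and signed composition -/

namespace Game

variable {n p q r : ℕ}

/-- The sum of a game and an additive game; its core is the translated core. -/
def translate (A : Game n) (t : Fin n → ℝ) : Game n where
  v S := A.v S + ∑ j ∈ S, t j
  grounded := by simp [A.grounded]

/-- The values of the one-player coalitions. -/
def singles (A : Game n) (j : Fin n) : ℝ := A.v {j}

/-- The translate of a game whose values at one-player coalitions are the
absolute values of the given ones. -/
def absTranslate (A : Game n) : Game n := A.translate (|A.singles| - A.singles)

theorem singles_translate (A : Game n) (t : Fin n → ℝ) :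
    (A.translate t).singles = A.singles + t := by
  ext j; simp [singles, translate]

theorem translate_translate (A : Game n) (t t' : Fin n → ℝ) :
    (A.translate t).translate t' = A.translate (t + t') := by
  ext S; simp [translate, Finset.sum_add_distrib, add_assoc]

theorem translate_zero (A : Game n) : A.translate 0 = A := by
  ext S; simp [translate]

theorem singles_absTranslate (A : Game n) : A.absTranslate.singles = |A.singles| := by
  simp [absTranslate, singles_translate]

theorem translate_absTranslate (A : Game n) :
    A.absTranslate.translate (A.singles - |A.singles|) = A := by
  rw [absTranslate, translate_translate, sub_add_sub_cancel, sub_self, translate_zero]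

theorem IsConvex.translate {A : Game n} (hA : A.IsConvex) (t : Fin n → ℝ) :
    (A.translate t).IsConvex := fun S T => by
  have := hA S T
  have := Finset.sum_union_inter (s₁ := S) (s₂ := T) (f := t)
  simp only [Game.translate]
  linarith

/-- By superadditivity, players can be added one at a time without losing non-negativity. -/
theorem IsConvex.isNonneg_of_singles {A : Game n} (hA : A.IsConvex) (h : 0 ≤ A.singles) :
    A.IsNonneg := fun S => by
  induction S using Finset.induction_on with
  | empty => exact A.grounded.ge
  | insert a S ha ih =>
    have := hA {a} S
    rw [Finset.singleton_inter_of_notMem ha, A.grounded, ← Finset.insert_eq] at this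
    have : 0 ≤ A.v {a} := h a
    linarith

theorem IsNonneg.absTranslate_eq {A : Game n} (hA : A.IsNonneg) : A.absTranslate = A := by
  have : |A.singles| = A.singles := abs_of_nonneg fun j => hA {j}
  rw [absTranslate, this, sub_self, translate_zero]

theorem IsConvex.absTranslate {A : Game n} (hA : A.IsConvex) : A.absTranslate.IsConvex :=
  hA.translate _

theorem IsConvex.isNonneg_absTranslate {A : Game n} (hA : A.IsConvex) :
    A.absTranslate.IsNonneg :=
  hA.absTranslate.isNonneg_of_singles (by rw [singles_absTranslate]; exact abs_nonneg _)

theorem singles_act (σ : Perm (Fin n)) (A : Game n) :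
    (A.act σ).singles = fun j => A.singles (σ⁻¹ j) := by
  ext j; simp [singles, act]

theorem absTranslate_act (σ : Perm (Fin n)) (A : Game n) :
    (A.act σ).absTranslate = A.absTranslate.act σ := by
  ext S
  simp only [absTranslate, translate, act]
  rw [Finset.sum_image (σ⁻¹).injective.injOn]
  rfl

theorem singles_comp (h : r + 1 = p + q) (i : Fin p) (A : Game p) (B : Game q) :
    (comp h i A B).singles = slotVector h i (B.v Finset.univ) A.singles B.singles := by
  funext j
  revert j
  refine forall_slots h i (fun a => ?_) (fun b => ?_)
  · have ho : outerPart h i {outerPos h i a} = {a.1} := by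
      rw [← insert_empty_eq, outerPart_insert_outerPos]; simp [outerPart]
    have hi : innerPart h i {outerPos h i a} = ∅ := by
      rw [← insert_empty_eq, innerPart_insert_outerPos]; simp [innerPart]
    rw [slotVector_outerPos, singles, comp_v, ho, hi, B.grounded, mul_zero, add_zero, singles]
  · have ho : outerPart h i {innerPos h i b} = ∅ := by
      rw [← insert_empty_eq, outerPart_insert_innerPos]; simp [outerPart]
    have hi : innerPart h i {innerPos h i b} = {b} := by
      rw [← insert_empty_eq, innerPart_insert_innerPos]; simp [innerPart]
    rw [slotVector_innerPos, singles, comp_v, ho, hi, A.grounded]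
    simp [singles]

/-- Multiplicativity of the absolute value. Only the grand coalition factor `c` is left without
absolute value, hence its sign condition. -/
theorem abs_slotVector (h : r + 1 = p + q) (i : Fin p) {c : ℝ} (hc : 0 ≤ c) (a : Fin p → ℝ)
    (b : Fin q → ℝ) : |slotVector h i c a b| = slotVector h i c |a| |b| := by
  funext j
  revert j
  refine forall_slots h i (fun x => ?_) (fun y => ?_)
  · simp [slotVector_outerPos, abs_mul, abs_of_nonneg hc]
  · simp [slotVector_innerPos, abs_mul]

/-- The composition of convex games of any sign: games are composed after passing to the
translates with non-negative values at singletons, and the signs of the values at singletons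
are multiplied. -/
noncomputable def signedComp (h : r + 1 = p + q) (i : Fin p) (A : Game p) (B : Game q) :
    Game r :=
  (comp h i A.absTranslate B.absTranslate).translate
    (slotVector h i (B.absTranslate.v Finset.univ) A.singles B.singles -
      slotVector h i (B.absTranslate.v Finset.univ) |A.singles| |B.singles|)

theorem singles_signedComp (h : r + 1 = p + q) (i : Fin p) (A : Game p) (B : Game q) :
    (signedComp h i A B).singles =
      slotVector h i (B.absTranslate.v Finset.univ) A.singles B.singles := by
  rw [signedComp, singles_translate, singles_comp, singles_absTranslate, singles_absTranslate]
  abel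

/-- With `singles_signedComp`, this makes `A ↦ (A.absTranslate, A.singles)` compatible with
composition in `markedGameOperad`, so that the operad axioms pull back. -/
theorem absTranslate_signedComp (h : r + 1 = p + q) (i : Fin p) (A : Game p) {B : Game q}
    (hB : B.IsConvex) :
    (signedComp h i A B).absTranslate = comp h i A.absTranslate B.absTranslate := by
  rw [absTranslate, singles_signedComp, abs_slotVector h i (hB.isNonneg_absTranslate _),
    signedComp, translate_translate, sub_add_sub_cancel, sub_self, translate_zero]

theorem signedComp_eq_comp (h : r + 1 = p + q) (i : Fin p) {A : Game p} {B : Game q}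
    (hA : A.IsNonneg) (hB : B.IsNonneg) : signedComp h i A B = comp h i A B := by
  have h₁ : |A.singles| = A.singles := abs_of_nonneg fun j => hA {j}
  have h₂ : |B.singles| = B.singles := abs_of_nonneg fun j => hB {j}
  rw [signedComp, h₁, h₂, sub_self, translate_zero, hA.absTranslate_eq, hB.absTranslate_eq]

end Game

/-- The operad of convex games. -/
noncomputable def ConvexGame.operad : SetOperad ConvexGame :=
  markedGameOperad.ofInjective (fun _ A => (A.1.absTranslate, A.1.singles))
    (fun _ A B h => by
      have h₁ : A.1.absTranslate = B.1.absTranslate := congrArg Prod.fst h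
      have h₂ : A.1.singles = B.1.singles := congrArg Prod.snd h
      exact Subtype.ext (by
        rw [← A.1.translate_absTranslate, ← B.1.translate_absTranslate, h₁, h₂]))
    (fun σ A => ⟨A.1.act σ, A.2.act σ⟩)
    (fun h i A B => ⟨Game.signedComp h i A.1 B.1,
      (A.2.absTranslate.comp h i A.2.isNonneg_absTranslate B.2.absTranslate
        B.2.isNonneg_absTranslate).translate _⟩)
    ⟨Game.trivial, Game.isConvex_trivial⟩
    (fun σ A => Prod.ext (Game.absTranslate_act σ A.1) (Game.singles_act σ A.1))
    (fun h i A B => Prod.ext (Game.absTranslate_signedComp h i A.1 B.2)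
      (Game.singles_signedComp h i A.1 B.1))
    (Prod.ext Game.isNonneg_trivial.absTranslate_eq
      (by funext j; simp [Game.singles, Game.trivial, markedGameOperad]))

/-- Non-negative convex games form a suboperad of the operad of convex games. -/
theorem NonnegConvexGame.isOperadHom_convexGame :
    IsOperadHom NonnegConvexGame.operad ConvexGame.operad (fun _ A => ⟨A.1, A.2.2⟩) where
  map_act _ _ := rfl
  map_comp h i A B := Subtype.ext (Game.signedComp_eq_comp h i A.2.1 B.2.1).symm
  map_one := rfl

end GameOperad

theorem mainTheorem8 :
    ∃ (opG : GameOperad.SetOperad GameOperad.Game)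
      (opC : GameOperad.SetOperad GameOperad.NonnegConvexGame)
      (opP : GameOperad.SetOperad GameOperad.OrthantGenPermutahedron)
      (opQ : GameOperad.SetOperad GameOperad.GenPermutahedron)
      (C : ∀ n, GameOperad.NonnegConvexGame n → GameOperad.OrthantGenPermutahedron n),
      -- `opG` is the operad of cooperative games
      ((∀ {n : ℕ} (σ : Equiv.Perm (Fin n)) (Γ : GameOperad.Game n),
          opG.act σ Γ = GameOperad.Game.act σ Γ) ∧
        (∀ {p q r : ℕ} (h : r + 1 = p + q) (i : Fin p)
          (A : GameOperad.Game p) (B : GameOperad.Game q),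
          opG.comp h i A B = GameOperad.Game.comp h i A B) ∧
        opG.one = GameOperad.Game.trivial) ∧
      -- `opC` is its suboperad of non-negative convex games
      GameOperad.IsOperadHom opC opG (fun _ Γ => Γ.1) ∧
      -- `C` is the core, and it is an isomorphism of operads from `opC` to `opP`
      (∀ (n : ℕ) (Γ : GameOperad.NonnegConvexGame n), (C n Γ).1 = Γ.1.core) ∧
      (∀ n, Function.Bijective (C n)) ∧
      GameOperad.IsOperadHom opC opP C ∧
      -- symmetric groups act on generalized permutahedra by permuting the coordinates
      (∀ {n : ℕ} (σ : Equiv.Perm (Fin n)) (P : GameOperad.OrthantGenPermutahedron n),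
        (opP.act σ P).1 = GameOperad.permuteCoords σ P.1) ∧
      (∀ {n : ℕ} (σ : Equiv.Perm (Fin n)) (P : GameOperad.GenPermutahedron n),
        (opQ.act σ P).1 = GameOperad.permuteCoords σ P.1) ∧
      -- `opP` is a suboperad of `opQ`
      GameOperad.IsOperadHom opP opQ (fun _ P => ⟨P.1, P.2.1⟩) := by
  refine ⟨GameOperad.Game.operad, GameOperad.NonnegConvexGame.operad,
    GameOperad.NonnegConvexGame.operad.transport GameOperad.NonnegConvexGame.coreEquiv,
    GameOperad.ConvexGame.operad.transport GameOperad.ConvexGame.coreEquiv,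
    fun n => GameOperad.NonnegConvexGame.coreEquiv n,
    ⟨fun _ _ => rfl, fun _ _ _ _ => rfl, rfl⟩, ⟨fun _ _ => rfl, fun _ _ _ _ => rfl, rfl⟩,
    fun _ _ => rfl, fun n => (GameOperad.NonnegConvexGame.coreEquiv n).bijective,
    GameOperad.SetOperad.isOperadHom_transport _ _, fun {n} σ P => ?_, fun {n} σ P => ?_,
    GameOperad.NonnegConvexGame.isOperadHom_convexGame.transport _ _ _ fun _ _ => rfl⟩
  -- Every polytope here is a core, and on cores the transported action comes from the action on
  -- games.
  · obtain ⟨A, rfl⟩ := (GameOperad.NonnegConvexGame.coreEquiv n).surjective P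
    rw [← (GameOperad.SetOperad.isOperadHom_transport _ _).map_act]
    exact GameOperad.Game.core_act σ A.1
  · obtain ⟨A, rfl⟩ := (GameOperad.ConvexGame.coreEquiv n).surjective P
    rw [← (GameOperad.SetOperad.isOperadHom_transport _ _).map_act]
    exact GameOperad.Game.core_act σ A.1
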